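/- Let $X$ be a non-empty topological space. Write $[X]^{<\omega}$ for the family of non-empty finite subsets of $X$, $K(X)$ for the family of non-empty compact subsets of $X$, and $\mathscr T_X$ for the family of non-empty open sets $U\subsetneq X$. For a family $\mathcal A$ of non-empty subsets of $X$ put $\mathscr N_X(A)=\{U\in\mathscr T_X: A\subseteq U\}$ and $\mathscr N_X[\mathcal A]=\{\mathscr N_X(A):A\in\mathcal A\}$. An $\mathcal A$-cover is an open cover $\mathscr U\subseteq\mathscr T_X$ of $X$ such that every $A\in\mathcal A$ is contained in some $U\in\mathscr U$. Let $\Omega_X$ be the set of all $[X]^{<\omega}$-covers ($\omega$-covers), $\mathcal K_X$ the set of all $K(X)$-covers ($k$-covers), and $\mathrm{DO}_X$ the set of all $\mathscr U\subseteq\mathscr T_X$ such that $\bigcup\mathscr U$ is dense in $X$; $\neg\mathrm{DO}_X$ denotes the collection of sets not in $\mathrm{DO}_X$. Let $wkc(K(X))$ be the least cardinality of a subfamily $\mathscr F\subseteq K(X)$ such that $\bigcup\mathscr F$ is dense in $X$. In the game $\mathsf G_1(\mathcal A,\mathcal B)$, in each round $n\in\omega$ One chooses $A_n\in\mathcal A$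 and Two responds with some $x_n\in A_n$; Two wins if $\{x_n:n\in\omega\}\in\mathcal B$, and otherwise One wins. For a game $\mathcal G$, write $\mathrm I\uparrow\mathcal G$ (resp. $\mathrm{II}\uparrow\mathcal G$) if One (resp. Two) has a winning strategy that may use all earlier moves of the opponent (for Two, including One's current move), $\mathrm I\underset{\mathrm{pre}}{\uparrow}\mathcal G$ if One has a winning strategy that depends only on the number of the current turn, and $\mathrm{II}\underset{\mathrm{mark}}{\uparrow}\mathcal G$ if Two has a winning strategy that depends only on One's most recent move and the number of the current turn. If $X$ is regular, then $$X\text{ is separable}\iff \mathrm I\underset{\mathrm{pre}}{\uparrow}\mathsf G_1(\mathscr N_X[[X]^{<\omega}],\neg\mathrm{DO}_X)\iff \mathrm{II}\underset{\mathrm{mark}}{\uparrow}\mathsf G_1(\Omega_X,\mathrm{DO}_X)$$ and $$wkc(K(X))\le\omega\iff \mathrm I\underset{\mathrm{pre}}{\uparrow}\mathsf G_1(\mathscr N_X[K(X)],\neg\mathrm{DO}_X)\iff \mathrm{II}\underset{\mathrm{mark}}{\uparrow}\mathsf G_1(\mathcal K_X,\mathrm{DO}_X).$$ If $X$ is, in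 addition, metrizable, then $$\begin{aligned}X\text{ is separable}&\iff \mathrm I\underset{\mathrm{pre}}{\uparrow}\mathsf G_1(\mathscr N_X[[X]^{<\omega}],\neg\mathrm{DO}_X)\iff \mathrm I\uparrow\mathsf G_1(\mathscr N_X[[X]^{<\omega}],\neg\mathrm{DO}_X)\\&\iff \mathrm{II}\underset{\mathrm{mark}}{\uparrow}\mathsf G_1(\Omega_X,\mathrm{DO}_X)\iff \mathrm{II}\uparrow\mathsf G_1(\Omega_X,\mathrm{DO}_X)\end{aligned}$$ and $$\begin{aligned}wkc(K(X))\le\omega&\iff \mathrm I\underset{\mathrm{pre}}{\uparrow}\mathsf G_1(\mathscr N_X[K(X)],\neg\mathrm{DO}_X)\iff \mathrm I\uparrow\mathsf G_1(\mathscr N_X[K(X)],\neg\mathrm{DO}_X)\\&\iff \mathrm{II}\underset{\mathrm{mark}}{\uparrow}\mathsf G_1(\mathcal K_X,\mathrm{DO}_X)\iff \mathrm{II}\uparrow\mathsf G_1(\mathcal K_X,\mathrm{DO}_X).\end{aligned}$$ -/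

import Mathlib

open Set TopologicalSpace

namespace SelGame

universe u

/-! ### Single-selection games

`G₁(𝒜, ℬ)`: in round `n`, One chooses `Aₙ ∈ 𝒜` and Two answers with some `xₙ ∈ Aₙ`.
Two wins the play if and only if `{xₙ : n ∈ ℕ} ∈ ℬ`. -/

section Games

variable {α : Type u}

/-- One has a winning (full-information) strategy in `G₁(𝒜, ℬ)`: a function `σ` sending each finite
sequence of elements of `⋃ 𝒜` (the earlier moves of Two) to an element of `𝒜`, such that Two loses
every play in which One follows `σ`. -/
def OneWins (𝒜 ℬ : Set (Set α)) : Prop :=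
  ∃ σ : (n : ℕ) → (Fin n → ⋃₀ 𝒜) → 𝒜,
    ∀ x : ℕ → ⋃₀ 𝒜,
      (∀ n : ℕ, (x n : α) ∈ (σ n (fun k : Fin n => x k) : Set α)) →
        range (fun n : ℕ => (x n : α)) ∉ ℬ

/-- One has a winning predetermined strategy in `G₁(𝒜, ℬ)`: One's moves depend only on the number
of the current turn. -/
def OnePreWins (𝒜 ℬ : Set (Set α)) : Prop :=
  ∃ σ : ℕ → 𝒜,
    ∀ x : ℕ → α, (∀ n : ℕ, x n ∈ (σ n : Set α)) → range x ∉ ℬ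

/-- Two has a winning (full-information) strategy in `G₁(𝒜, ℬ)`: a function `τ` which sends the
moves `A₀, …, Aₙ` of One to a legal answer, that is to an element of `Aₙ`, such that Two wins every
play in which Two follows `τ`. -/
def TwoWins (𝒜 ℬ : Set (Set α)) : Prop :=
  ∃ τ : (n : ℕ) → (Fin (n + 1) → 𝒜) → α,
    (∀ (n : ℕ) (A : Fin (n + 1) → 𝒜), τ n A ∈ (A (Fin.last n) : Set α)) ∧
      ∀ A : ℕ → 𝒜, range (fun n : ℕ => τ n (fun k : Fin (n + 1) => A k)) ∈ ℬ

/-- Two has a winning Markov strategy in `G₁(𝒜, ℬ)`: Two's (legal) answer depends only on the most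
recent move of One and the number of the current turn. -/
def TwoMarkovWins (𝒜 ℬ : Set (Set α)) : Prop :=
  ∃ τ : 𝒜 → ℕ → α,
    (∀ (A : 𝒜) (n : ℕ), τ A n ∈ (A : Set α)) ∧
      ∀ A : ℕ → 𝒜, range (fun n : ℕ => τ (A n) n) ∈ ℬ

end Games

/-! ### The families of sets that are played with -/

section Families

variable (X : Type u)

/-- `[X]^{<ω}`, as an ideal of sets: the non-empty finite subsets of `X`. -/
def finiteSets : Set (Set X) :=
  {A | A.Nonempty ∧ A.Finite}

variable [TopologicalSpace X]

/-- `K(X)`: the non-empty compact subsets of `X`. -/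
def compactSets : Set (Set X) :=
  {A | A.Nonempty ∧ IsCompact A}

/-- `𝒯_X`: the proper non-empty open subsets of `X`. -/
def properOpens : Set (Set X) :=
  {U | IsOpen U ∧ U.Nonempty ∧ U ≠ univ}

variable {X}

/-- `𝒩_X(A)`: the proper non-empty open sets that contain `A`. -/
def nhds (A : Set X) : Set (Set X) :=
  {U | U ∈ properOpens X ∧ A ⊆ U}

/-- `𝒩_X[𝒜] = {𝒩_X(A) : A ∈ 𝒜}`. -/
def nhdsFamily (𝒜 : Set (Set X)) : Set (Set (Set X)) :=
  nhds '' 𝒜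

/-- `𝒪_X(𝒜)`: the non-trivial open covers `𝒰` of `X` (so neither `∅` nor `X` belongs to `𝒰`)
such that every `A ∈ 𝒜` is contained in some member of `𝒰`. -/
def covers (𝒜 : Set (Set X)) : Set (Set (Set X)) :=
  {𝒰 | (∀ U ∈ 𝒰, IsOpen U) ∧ ⋃₀ 𝒰 = univ ∧ ∅ ∉ 𝒰 ∧ univ ∉ 𝒰 ∧ ∀ A ∈ 𝒜, ∃ U ∈ 𝒰, A ⊆ U}

variable (X)

/-- `Ω_X`: the `ω`-covers of `X`. -/
def omegaCovers : Set (Set (Set X)) :=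
  covers (finiteSets X)

/-- `𝒦_X`: the `k`-covers of `X`. -/
def kCovers : Set (Set (Set X)) :=
  covers (compactSets X)

/-- `DO_X`: the families of proper non-empty open sets whose union is dense in `X`. -/
def denseOpenFamilies : Set (Set (Set X)) :=
  {𝒰 | 𝒰 ⊆ properOpens X ∧ closure (⋃₀ 𝒰) = univ}

variable {X}

/-- The weak covering number `wkc(𝒜)`: the least cardinality of a subfamily of `𝒜` with dense
union. (For `𝒜 = K(X)` such subfamilies exist, for instance `K(X)` itself.) -/
noncomputable def wkc (𝒜 : Set (Set X)) : Cardinal.{u} :=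
  sInf {κ : Cardinal.{u} | ∃ ℱ : Set (Set X), ℱ ⊆ 𝒜 ∧ Cardinal.mk ℱ = κ ∧ closure (⋃₀ ℱ) = univ}

end Families

end SelGame

namespace SelGame

/-! Separability and `wkc(K(X)) ≤ ω` both say that countably many members of `𝒜` have dense union,
for `𝒜` the finite or the compact sets; the games are treated for general `𝒜`. If the union of `F n`
is dense, One plays `nhds (F n)`, and Two answers covers by members containing `F n`. Conversely, if
the countably many sets offered by a predetermined strategy had non-dense union, regularity would
give a non-dense open `W` around it, and Two would defeat One by always playing `W`. Two's
strategies reduce to One's by `exists_nhds_subset_range`. A full strategy has too many histories for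
this. In a metrizable space a compact set has a countable base of neighbourhoods, so it suffices to
follow a countable tree of histories, inside which Two can stay in `W`
(`hasCountableDenseSubfamily_of_history`). -/

theorem sUnion_finiteSets {X : Type*} : ⋃₀ finiteSets X = univ :=
  eq_univ_of_forall fun x => ⟨{x}, ⟨singleton_nonempty x, finite_singleton x⟩, rfl⟩

section CountableDense

variable {X : Type*} [TopologicalSpace X]

/-- Some countable subfamily of `𝒜` has dense union. -/
def HasCountableDenseSubfamily (𝒜 : Set (Set X)) : Prop :=
  ∃ ℱ : Set (Set X), ℱ ⊆ 𝒜 ∧ ℱ.Countable ∧ closure (⋃₀ ℱ) = univ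

theorem finiteSets_subset_compactSets : finiteSets X ⊆ compactSets X :=
  fun _ hA => ⟨hA.1, hA.2.isCompact⟩

theorem sUnion_compactSets : ⋃₀ compactSets X = univ :=
  eq_univ_of_forall fun x => ⟨{x}, ⟨singleton_nonempty x, isCompact_singleton⟩, rfl⟩

theorem separableSpace_iff_hasCountableDenseSubfamily :
    SeparableSpace X ↔ HasCountableDenseSubfamily (finiteSets X) := by
  constructor
  · rintro ⟨s, hs, hd⟩
    refine ⟨(fun x => {x}) '' s, ?_, hs.image _, ?_⟩
    · rintro _ ⟨x, -, rfl⟩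
      exact ⟨singleton_nonempty x, finite_singleton x⟩
    · rw [sUnion_image, biUnion_of_singleton]
      exact hd.closure_eq
  · rintro ⟨ℱ, hℱ, hc, hd⟩
    exact ⟨⋃₀ ℱ, hc.sUnion fun A hA => (hℱ hA).2.countable, dense_iff_closure_eq.2 hd⟩

theorem wkc_le_aleph0_iff {𝒜 : Set (Set X)} (h𝒜 : ⋃₀ 𝒜 = univ) :
    wkc 𝒜 ≤ Cardinal.aleph0 ↔ HasCountableDenseSubfamily 𝒜 := by
  constructor
  · intro h
    -- Cardinals are well-ordered, so the infimum is attained once `𝒜` itself is seen to qualify.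
    obtain ⟨ℱ, hℱ, hκ, hd⟩ := csInf_mem (s := {κ : Cardinal | ∃ ℱ : Set (Set X), ℱ ⊆ 𝒜 ∧
      Cardinal.mk ℱ = κ ∧ closure (⋃₀ ℱ) = univ}) ⟨_, 𝒜, Subset.rfl, rfl, by simp [h𝒜]⟩
    exact ⟨ℱ, hℱ, Cardinal.le_aleph0_iff_set_countable.1 (hκ.trans_le h), hd⟩
  · rintro ⟨ℱ, hℱ, hc, hd⟩
    have hle : wkc 𝒜 ≤ Cardinal.mk ℱ := csInf_le' ⟨ℱ, hℱ, rfl, hd⟩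
    exact hle.trans (Cardinal.le_aleph0_iff_set_countable.2 hc)

theorem HasCountableDenseSubfamily.exists_seq [Nonempty X] {𝒜 : Set (Set X)}
    (h : HasCountableDenseSubfamily 𝒜) :
    ∃ F : ℕ → Set X, (∀ n, F n ∈ 𝒜) ∧ closure (⋃ n, F n) = univ := by
  obtain ⟨ℱ, hℱ, hc, hd⟩ := h
  have hne : ℱ.Nonempty := by
    by_contra hemp
    rw [not_nonempty_iff_eq_empty] at hemp
    subst hemp
    rw [sUnion_empty, closure_empty] at hd
    exact empty_ne_univ hd
  obtain ⟨F, rfl⟩ := hc.exists_eq_range hne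
  exact ⟨F, fun n => hℱ ⟨n, rfl⟩, by rwa [sUnion_range] at hd⟩

theorem range_mem_denseOpenFamilies {F U : ℕ → Set X} (hF : closure (⋃ n, F n) = univ)
    (hU : ∀ n, U n ∈ nhds (F n)) : range U ∈ denseOpenFamilies X := by
  refine ⟨range_subset_iff.2 fun n => (hU n).1, ?_⟩
  rw [sUnion_range, ← univ_subset_iff, ← hF]
  exact closure_mono (iUnion_mono fun n => (hU n).2)

theorem HasCountableDenseSubfamily.onePreWins [Nonempty X] {𝒜 : Set (Set X)}
    (h : HasCountableDenseSubfamily 𝒜) :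
    OnePreWins (nhdsFamily 𝒜) (denseOpenFamilies X)ᶜ := by
  obtain ⟨F, hF, hd⟩ := h.exists_seq
  exact ⟨fun n => ⟨nhds (F n), F n, hF n, rfl⟩, fun x hx =>
    not_not_intro (range_mem_denseOpenFamilies hd hx)⟩

theorem mem_properOpens_of_mem_cover {𝒜 𝒰 : Set (Set X)} (h𝒰 : 𝒰 ∈ covers 𝒜) {U : Set X}
    (hU : U ∈ 𝒰) : U ∈ properOpens X :=
  ⟨h𝒰.1 U hU, nonempty_iff_ne_empty.2 fun h => h𝒰.2.2.1 (h ▸ hU),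
    fun h => h𝒰.2.2.2.1 (h ▸ hU)⟩

theorem HasCountableDenseSubfamily.twoMarkovWins [Nonempty X] {𝒜 : Set (Set X)}
    (h : HasCountableDenseSubfamily 𝒜) :
    TwoMarkovWins (covers 𝒜) (denseOpenFamilies X) := by
  obtain ⟨F, hF, hd⟩ := h.exists_seq
  choose τ hτ hτF using fun (𝒰 : covers 𝒜) (n : ℕ) => 𝒰.2.2.2.2.2 (F n) (hF n)
  exact ⟨τ, hτ, fun 𝒰 => range_mem_denseOpenFamilies hd fun n =>
    ⟨mem_properOpens_of_mem_cover (𝒰 n).2 (hτ _ n), hτF _ n⟩⟩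

/-- In a regular space, a non-dense set has an open neighbourhood that is still not dense. -/
theorem exists_isOpen_superset_closure_ne_univ [RegularSpace X] {S : Set X}
    (hS : closure S ≠ univ) : ∃ W, IsOpen W ∧ S ⊆ W ∧ closure W ≠ univ := by
  obtain ⟨y, hy⟩ := (ne_univ_iff_exists_notMem _).1 hS
  obtain ⟨t, ht, htc, hts⟩ :=
    exists_mem_nhds_isClosed_subset (isClosed_closure.isOpen_compl.mem_nhds hy)
  -- The closure of `tᶜ` is the complement of `interior t`, hence misses `y`.
  refine ⟨tᶜ, htc.isOpen_compl, fun x hx hxt => hts hxt (subset_closure hx), ?_⟩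
  rw [closure_compl, Ne, compl_univ_iff]
  exact (nonempty_iff_ne_empty.1 ⟨y, mem_interior_iff_mem_nhds.2 ht⟩)

/-- Lying in a non-dense set keeps `U` proper, hence a legal move. -/
theorem mem_nhds_of_closure_ne_univ {A U W : Set X} (hA : A.Nonempty) (hAU : A ⊆ U)
    (hU : IsOpen U) (hUW : U ⊆ W) (hW : closure W ≠ univ) : U ∈ nhds A :=
  ⟨⟨hU, hA.mono hAU, fun h => hW <| univ_subset_iff.1 <|
    h ▸ hUW.trans subset_closure⟩, hAU⟩

theorem hasCountableDenseSubfamily_of_onePreWins [RegularSpace X] {𝒜 : Set (Set X)}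
    (hne : ∀ A ∈ 𝒜, A.Nonempty) (h : OnePreWins (nhdsFamily 𝒜) (denseOpenFamilies X)ᶜ) :
    HasCountableDenseSubfamily 𝒜 := by
  obtain ⟨σ, hσ⟩ := h
  choose A hA hAσ using fun n => (σ n).2
  refine ⟨range A, range_subset_iff.2 hA, countable_range A, ?_⟩
  by_contra hd
  obtain ⟨W, hWo, hAW, hW⟩ := exists_isOpen_superset_closure_ne_univ hd
  refine hσ (fun _ => W) (fun n => ?_) fun hmem => hW (by simpa using hmem.2)
  rw [← hAσ n]
  exact mem_nhds_of_closure_ne_univ (hne _ (hA n))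
    ((subset_sUnion_of_mem (mem_range_self n)).trans hAW) hWo Subset.rfl hW

/-- A choice function on the `𝒜`-covers takes as values all the proper open neighbourhoods of some
member of `𝒜`. -/
theorem exists_nhds_subset_range {𝒜 : Set (Set X)} (h𝒜 : ⋃₀ 𝒜 = univ)
    (f : covers 𝒜 → Set X) (hf : ∀ 𝒰 : covers 𝒜, f 𝒰 ∈ (𝒰 : Set (Set X))) :
    ∃ A ∈ 𝒜, nhds A ⊆ range f := by
  -- Otherwise each `A` has a neighbourhood that `f` never selects; these form a cover, from which
  -- `f` must select one of them.
  by_contra! hcon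
  have hcon' : ∀ A : 𝒜, ∃ U, U ∈ nhds (A : Set X) ∧ U ∉ range f := fun A =>
    not_subset.1 (hcon A A.2)
  choose U hU hUf using hcon'
  have hcov : range U ∈ covers 𝒜 := by
    refine ⟨?_, ?_, ?_, ?_, fun A hA => ⟨U ⟨A, hA⟩, mem_range_self _, (hU ⟨A, hA⟩).2⟩⟩
    · rintro _ ⟨A, rfl⟩
      exact (hU A).1.1
    · rw [← univ_subset_iff, ← h𝒜]
      exact sUnion_subset fun A hA =>
        (hU ⟨A, hA⟩).2.trans (subset_sUnion_of_mem (mem_range_self _))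
    · rintro ⟨A, hA⟩
      exact (hU A).1.2.1.ne_empty hA
    · rintro ⟨A, hA⟩
      exact (hU A).1.2.2 hA
  obtain ⟨A, hA⟩ := hf ⟨range U, hcov⟩
  exact hUf A ⟨_, hA.symm⟩

/-- One offers `nhds (A n)`, all of whose members are answers of `τ` at turn `n`, so every play
against One is also a play following `τ`. -/
theorem TwoMarkovWins.onePreWins {𝒜 : Set (Set X)} (h𝒜 : ⋃₀ 𝒜 = univ)
    (h : TwoMarkovWins (covers 𝒜) (denseOpenFamilies X)) :
    OnePreWins (nhdsFamily 𝒜) (denseOpenFamilies X)ᶜ := by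
  obtain ⟨τ, hτ, hw⟩ := h
  choose A hA hAτ using fun n =>
    exists_nhds_subset_range h𝒜 (fun 𝒰 => τ 𝒰 n) (fun 𝒰 => hτ 𝒰 n)
  refine ⟨fun n => ⟨nhds (A n), A n, hA n, rfl⟩, fun x hx => not_not_intro ?_⟩
  choose 𝒰 h𝒰 using fun n => hAτ n (hx n)
  have hx' : x = fun n => τ (𝒰 n) n := funext fun n => (h𝒰 n).symm
  exact hx' ▸ hw 𝒰

theorem OnePreWins.oneWins {α : Type*} {𝒜 ℬ : Set (Set α)} (h : OnePreWins 𝒜 ℬ) :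
    OneWins 𝒜 ℬ := by
  obtain ⟨σ, hσ⟩ := h
  exact ⟨fun n _ => σ n, fun x hx => hσ (fun n => x n) hx⟩

theorem TwoMarkovWins.twoWins {α : Type*} {𝒜 ℬ : Set (Set α)} (h : TwoMarkovWins 𝒜 ℬ) :
    TwoWins 𝒜 ℬ := by
  obtain ⟨τ, hτ, hw⟩ := h
  exact ⟨fun n A => τ (A (Fin.last n)) n, fun n A => hτ _ n, fun A => by simpa using hw A⟩

theorem exists_seq_eq_of_history {γ : Type*} (p : (n : ℕ) → (Fin n → γ) → γ) :
    ∃ c : ℕ → γ, ∀ n, c n = p n fun k => c k := by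
  let c : ℕ → γ := WellFounded.fix Nat.lt_wfRel.wf fun n ih => p n fun k => ih k k.2
  exact ⟨c, fun n => WellFounded.fix_eq _ _ n⟩

theorem snoc_restrict {γ : Type*} (c : ℕ → γ) (n : ℕ) :
    (Fin.snoc (fun k : Fin n => c k) (c n) : Fin (n + 1) → γ) = fun k : Fin (n + 1) => c k := by
  ext k
  refine Fin.lastCases ?_ (fun i => ?_) k <;> simp

/-- After each history of moves in `γ`, a compact set `a n h` is offered, and a further move `c`
determines a set `out n h c`; every proper open neighbourhood of `a n h` arises in this way.
If the neighbourhoods produced along any play have dense union, then countably many of the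
offered compact sets have dense union. -/
theorem hasCountableDenseSubfamily_of_history [MetrizableSpace X] {𝒜 : Set (Set X)}
    (h𝒜 : 𝒜 ⊆ compactSets X) {γ : Type*} (a : (n : ℕ) → (Fin n → γ) → Set X)
    (ha : ∀ n h, a n h ∈ 𝒜) (out : (n : ℕ) → (Fin n → γ) → γ → Set X)
    (hout : ∀ n h, nhds (a n h) ⊆ range (out n h))
    (hwin : ∀ c : ℕ → γ, (∀ n, out n (fun k => c k) (c n) ∈ nhds (a n fun k => c k)) →
      closure (⋃ n, out n (fun k => c k) (c n)) = univ) :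
    HasCountableDenseSubfamily 𝒜 := by
  classical
  let _ : MetricSpace X := metrizableSpaceMetric X
  -- By compactness these thickenings are cofinal among the neighbourhoods of `a n h`.
  let U (n : ℕ) (h : Fin n → γ) (k : ℕ) : Set X := Metric.thickening (1 / ((k : ℝ) + 1)) (a n h)
  choose m hm using hout
  -- The countable tree: each history is extended by one chosen move per thickening that is a legal
  -- neighbourhood.
  let H : (n : ℕ) → Set (Fin n → γ) := fun n => Nat.rec (motive := fun n => Set (Fin n → γ)) univ
    (fun n Hn => ⋃ h ∈ Hn, ⋃ k : ℕ, ⋃ hk : U n h k ∈ nhds (a n h),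
      {(Fin.snoc h (m n h hk) : Fin (n + 1) → γ)}) n
  have hH : ∀ n, H (n + 1) = ⋃ h ∈ H n, ⋃ k : ℕ, ⋃ hk : U n h k ∈ nhds (a n h),
      {(Fin.snoc h (m n h hk) : Fin (n + 1) → γ)} := fun n => rfl
  have hHc : ∀ n, (H n).Countable := by
    intro n
    induction n with
    | zero => exact (toFinite _).countable
    | succ n ih =>
      rw [hH]
      exact ih.biUnion fun h _ => countable_iUnion fun k =>
        countable_iUnion fun _ => countable_singleton _
  refine ⟨⋃ n, a n '' H n, iUnion_subset fun n => image_subset_iff.2 fun h _ => ha n h,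
    countable_iUnion fun n => (hHc n).image _, ?_⟩
  by_contra hd
  obtain ⟨W, hWo, hAW, hW⟩ := exists_isOpen_superset_closure_ne_univ hd
  have hstep : ∀ n, ∀ h ∈ H n, ∃ k, ∃ _ : U n h k ∈ nhds (a n h), U n h k ⊆ W := by
    intro n h hh
    have haW : a n h ⊆ W :=
      (subset_sUnion_of_mem (mem_iUnion.2 ⟨n, mem_image_of_mem _ hh⟩)).trans hAW
    obtain ⟨δ, hδ, hδW⟩ := (h𝒜 (ha n h)).2.exists_thickening_subset_open hWo haW
    obtain ⟨k, hk⟩ := exists_nat_one_div_lt hδ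
    have hUW : U n h k ⊆ W := (Metric.thickening_mono hk.le _).trans hδW
    exact ⟨k, mem_nhds_of_closure_ne_univ (h𝒜 (ha n h)).1
      (Metric.self_subset_thickening (by positivity) _) Metric.isOpen_thickening hUW hW, hUW⟩
  have hmove : ∀ n, ∀ h : Fin n → γ, ∃ c : γ, h ∈ H n →
      Fin.snoc h c ∈ H (n + 1) ∧ out n h c ∈ nhds (a n h) ∧ out n h c ⊆ W := by
    have hmove' : ∀ n, ∀ h ∈ H n, ∃ c : γ,
        Fin.snoc h c ∈ H (n + 1) ∧ out n h c ∈ nhds (a n h) ∧ out n h c ⊆ W := by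
      intro n h hh
      obtain ⟨k, hk, hkW⟩ := hstep n h hh
      refine ⟨m n h hk, ?_, by rwa [hm], by rwa [hm]⟩
      rw [hH]
      exact mem_iUnion₂.2 ⟨h, hh, mem_iUnion₂.2 ⟨k, hk, rfl⟩⟩
    intro n h
    by_cases hh : h ∈ H n
    · exact (hmove' n h hh).imp fun _ hc _ => hc
    -- Off the tree any move will do; the root supplies one, since `γ` is not assumed inhabited.
    · exact ⟨(hmove' 0 Fin.elim0 (mem_univ _)).choose, fun h' => absurd h' hh⟩
  choose p hp using hmove
  obtain ⟨c, hc⟩ := exists_seq_eq_of_history p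
  have hcH : ∀ n, (fun k : Fin n => c k) ∈ H n := by
    intro n
    induction n with
    | zero => exact mem_univ _
    | succ n ih =>
      rw [← snoc_restrict, hc n]
      exact (hp n _ ih).1
  have hcW : ∀ n, out n (fun k => c k) (c n) ∈ nhds (a n fun k => c k) ∧
      out n (fun k => c k) (c n) ⊆ W := by
    intro n
    rw [hc n]
    exact (hp n _ (hcH n)).2
  apply hW
  rw [← univ_subset_iff, ← hwin c fun n => (hcW n).1]
  exact closure_mono (iUnion_subset fun n => (hcW n).2)

theorem hasCountableDenseSubfamily_of_oneWins [MetrizableSpace X] {𝒜 : Set (Set X)}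
    (h𝒜 : 𝒜 ⊆ compactSets X) (h : OneWins (nhdsFamily 𝒜) (denseOpenFamilies X)ᶜ) :
    HasCountableDenseSubfamily 𝒜 := by
  obtain ⟨σ, hσ⟩ := h
  choose a ha haσ using fun n h => (σ n h).2
  -- Here histories consist of Two's neighbourhoods themselves.
  refine hasCountableDenseSubfamily_of_history h𝒜 a ha (fun _ _ U => U) (fun n h U hU =>
    ⟨⟨U, nhds (a n h), ⟨_, ha n h, rfl⟩, hU⟩, rfl⟩) fun c hc => ?_
  rw [← sUnion_range]
  exact (not_not.1 (hσ c fun n => haσ n _ ▸ hc n)).2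

theorem hasCountableDenseSubfamily_of_twoWins [MetrizableSpace X] {𝒜 : Set (Set X)}
    (h𝒜 : 𝒜 ⊆ compactSets X) (hcov : ⋃₀ 𝒜 = univ)
    (h : TwoWins (covers 𝒜) (denseOpenFamilies X)) :
    HasCountableDenseSubfamily 𝒜 := by
  obtain ⟨τ, hτ, hw⟩ := h
  choose a ha haτ using fun (n : ℕ) (h : Fin n → covers 𝒜) =>
    exists_nhds_subset_range hcov (fun 𝒰 => τ n (Fin.snoc h 𝒰))
      (fun 𝒰 => by simpa using hτ n (Fin.snoc h 𝒰))
  -- Here histories consist of One's covers, and a further cover produces Two's answer to it.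
  refine hasCountableDenseSubfamily_of_history h𝒜 a ha (fun n h 𝒰 => τ n (Fin.snoc h 𝒰)) haτ
    fun c _ => ?_
  simp only [snoc_restrict]
  rw [← sUnion_range]
  exact (hw c).2

theorem hasCountableDenseSubfamily_iff_markov [RegularSpace X] [Nonempty X] {𝒜 : Set (Set X)}
    (hne : ∀ A ∈ 𝒜, A.Nonempty) (hcov : ⋃₀ 𝒜 = univ) :
    (HasCountableDenseSubfamily 𝒜 ↔ OnePreWins (nhdsFamily 𝒜) (denseOpenFamilies X)ᶜ) ∧
      (HasCountableDenseSubfamily 𝒜 ↔ TwoMarkovWins (covers 𝒜) (denseOpenFamilies X)) :=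
  ⟨⟨fun h => h.onePreWins, hasCountableDenseSubfamily_of_onePreWins hne⟩,
    ⟨fun h => h.twoMarkovWins,
      fun h => hasCountableDenseSubfamily_of_onePreWins hne (h.onePreWins hcov)⟩⟩

theorem hasCountableDenseSubfamily_iff_full [MetrizableSpace X] [Nonempty X] {𝒜 : Set (Set X)}
    (h𝒜 : 𝒜 ⊆ compactSets X) (hcov : ⋃₀ 𝒜 = univ) :
    (HasCountableDenseSubfamily 𝒜 ↔ OneWins (nhdsFamily 𝒜) (denseOpenFamilies X)ᶜ) ∧
      (HasCountableDenseSubfamily 𝒜 ↔ TwoWins (covers 𝒜) (denseOpenFamilies X)) :=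
  ⟨⟨fun h => h.onePreWins.oneWins, hasCountableDenseSubfamily_of_oneWins h𝒜⟩,
    ⟨fun h => h.twoMarkovWins.twoWins, hasCountableDenseSubfamily_of_twoWins h𝒜 hcov⟩⟩

end CountableDense

end SelGame

theorem corollary3p19 {X : Type*} [TopologicalSpace X] [RegularSpace X] [Nonempty X] :
    ((SeparableSpace X ↔
        SelGame.OnePreWins (SelGame.nhdsFamily (SelGame.finiteSets X))
          (SelGame.denseOpenFamilies X)ᶜ) ∧
      (SeparableSpace X ↔
        SelGame.TwoMarkovWins (SelGame.omegaCovers X) (SelGame.denseOpenFamilies X))) ∧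
    ((SelGame.wkc (SelGame.compactSets X) ≤ Cardinal.aleph0 ↔
        SelGame.OnePreWins (SelGame.nhdsFamily (SelGame.compactSets X))
          (SelGame.denseOpenFamilies X)ᶜ) ∧
      (SelGame.wkc (SelGame.compactSets X) ≤ Cardinal.aleph0 ↔
        SelGame.TwoMarkovWins (SelGame.kCovers X) (SelGame.denseOpenFamilies X))) ∧
    (MetrizableSpace X →
      ((SeparableSpace X ↔
          SelGame.OnePreWins (SelGame.nhdsFamily (SelGame.finiteSets X))
            (SelGame.denseOpenFamilies X)ᶜ) ∧
        (SeparableSpace X ↔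
          SelGame.OneWins (SelGame.nhdsFamily (SelGame.finiteSets X))
            (SelGame.denseOpenFamilies X)ᶜ) ∧
        (SeparableSpace X ↔
          SelGame.TwoMarkovWins (SelGame.omegaCovers X) (SelGame.denseOpenFamilies X)) ∧
        (SeparableSpace X ↔
          SelGame.TwoWins (SelGame.omegaCovers X) (SelGame.denseOpenFamilies X))) ∧
      ((SelGame.wkc (SelGame.compactSets X) ≤ Cardinal.aleph0 ↔
          SelGame.OnePreWins (SelGame.nhdsFamily (SelGame.compactSets X))
            (SelGame.denseOpenFamilies X)ᶜ) ∧
        (SelGame.wkc (SelGame.compactSets X) ≤ Cardinal.aleph0 ↔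
          SelGame.OneWins (SelGame.nhdsFamily (SelGame.compactSets X))
            (SelGame.denseOpenFamilies X)ᶜ) ∧
        (SelGame.wkc (SelGame.compactSets X) ≤ Cardinal.aleph0 ↔
          SelGame.TwoMarkovWins (SelGame.kCovers X) (SelGame.denseOpenFamilies X)) ∧
        (SelGame.wkc (SelGame.compactSets X) ≤ Cardinal.aleph0 ↔
          SelGame.TwoWins (SelGame.kCovers X) (SelGame.denseOpenFamilies X)))) := by
  rw [SelGame.separableSpace_iff_hasCountableDenseSubfamily,
    SelGame.wkc_le_aleph0_iff SelGame.sUnion_compactSets]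
  have hf := SelGame.hasCountableDenseSubfamily_iff_markov (X := X)
    (𝒜 := SelGame.finiteSets X) (fun A hA => hA.1) SelGame.sUnion_finiteSets
  have hk := SelGame.hasCountableDenseSubfamily_iff_markov (X := X)
    (𝒜 := SelGame.compactSets X) (fun A hA => hA.1) SelGame.sUnion_compactSets
  refine ⟨hf, hk, fun _ => ?_⟩
  have hf' := SelGame.hasCountableDenseSubfamily_iff_full (X := X)
    SelGame.finiteSets_subset_compactSets SelGame.sUnion_finiteSets
  have hk' := SelGame.hasCountableDenseSubfamily_iff_full (X := X)
    (𝒜 := SelGame.compactSets X) Subset.rfl SelGame.sUnion_compactSets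
  exact ⟨⟨hf.1, hf'.1, hf.2, hf'.2⟩, ⟨hk.1, hk'.1, hk.2, hk'.2⟩⟩
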